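/- Let $\mathbb F$ be a field and let $\mathcal M=(\mathcal M(n))_{n\ge 0}$ be a $\Sigma$-module, i.e. each $\mathcal M(n)$ is an $\mathbb F$-linear representation of the symmetric group $\Sigma_n$. Suppose that each $\mathcal M(n)$ is endowed with a basis $\mathcal B(n)$ which is stable under the action of $\Sigma_n$. *Notation.* $\operatorname{Comp}_p(n)$ is the set of $p$-tuples $r=(r_1,\dots,r_p)$ of non-negative integers with $r_1+\dots+r_p=n$; such an $r$ cuts $\{1,\dots,n\}$ into consecutive blocks of sizes $r_1,\dots,r_p$, and $\Sigma_r\cong\Sigma_{r_1}\times\dots\times\Sigma_{r_p}\subseteq\Sigma_n$ is the subgroup preserving each block. For $\rho\in\Sigma_p$, $r^\rho=(r_{\rho^{-1}(1)},\dots,r_{\rho^{-1}(p)})$ and $\rho^*\in\Sigma_n$ is the block permutation sending the $i$-th block of $r$ to the $\rho(i)$-th block of $r^\rho$ in an order-preserving way. For $q\in\operatorname{Comp}_s(p)$, $q\rhd r\in\operatorname{Comp}_s(n)$ has as $j$-th entry the sum of the $r_i$ with $i$ in the $j$-th block of $q$. For $l+m=r_1$, $r\circ_1(l,m)=(l,m,r_2,\dots,r_p)$.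 For $x\in\mathcal B(n)$, $[x]_r$, $\Omega_r(x)$ and $\operatorname{Stab}_r(x)$ are the class, the orbit and the stabiliser of $x$ under $\Sigma_r$. *The category $\beta(\mathcal M)$.* Objects are $\mathbb F$-vector spaces $A$ with maps $\beta_{x,r}:A^{\times p}\to A$ for all $n$, $p$, $r\in\operatorname{Comp}_p(n)$ and $x\in\mathcal M(n)^{\Sigma_r}$, such that - ($\beta$1) $\beta_{x,r}(a_1,\dots,a_p)=\beta_{\rho^*\cdot x,r^\rho}(a_{\rho^{-1}(1)},\dots,a_{\rho^{-1}(p)})$ for $\rho\in\Sigma_p$; - ($\beta$2) $\beta_{x,(0,r_1,\dots,r_p)}(a_0,a_1,\dots,a_p)=\beta_{x,r}(a_1,\dots,a_p)$; - ($\beta$3) $\beta_{x,r}(\lambda a_1,a_2,\dots,a_p)=\lambda^{r_1}\beta_{x,r}(a_1,\dots,a_p)$ for $\lambda\in\mathbb F$; - ($\beta$4) $\beta_{x,r}(\underbrace{a_1,\dots,a_1}_{q_1},\dots,\underbrace{a_s,\dots,a_s}_{q_s})=\beta_{\sum_{\sigma\in\Sigma_{q\rhd r}/\Sigma_r}\sigma\cdot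 x,\;q\rhd r}(a_1,\dots,a_s)$ for $q\in\operatorname{Comp}_s(p)$; - ($\beta$5) $\beta_{x,r}(a_0+a_1,a_2,\dots,a_p)=\sum_{l+m=r_1}\beta_{x,r\circ_1(l,m)}(a_0,a_1,\dots,a_p)$; - ($\beta$6) $\beta_{\lambda x+y,r}=\lambda\beta_{x,r}+\beta_{y,r}$ for $\lambda\in\mathbb F$ and $x,y\in\mathcal M(n)^{\Sigma_r}$. Morphisms are the linear maps compatible with all operations. *The category $\gamma(\mathcal M)$.* Objects are $\mathbb F$-vector spaces $A$ with maps $\gamma_{[x]_r,r}:A^{\times p}\to A$ for all $n$, $p$, $r\in\operatorname{Comp}_p(n)$ and $[x]_r\in\Sigma_r\backslash\mathcal B(n)$, such that - ($\gamma$1) $\gamma_{[x]_r,r}(a_1,\dots,a_p)=\gamma_{[\rho^*\cdot x]_{r^\rho},r^\rho}(a_{\rho^{-1}(1)},\dots,a_{\rho^{-1}(p)})$ for $\rho\in\Sigma_p$; - ($\gamma$2) $\gamma_{[x],(0,r_1,\dots,r_p)}(a_0,a_1,\dots,a_p)=\gamma_{[x]_r,r}(a_1,\dots,a_p)$; - ($\gamma$3)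 $\gamma_{[x]_r,r}(\lambda a_1,a_2,\dots,a_p)=\lambda^{r_1}\gamma_{[x]_r,r}(a_1,\dots,a_p)$ for $\lambda\in\mathbb F$; - ($\gamma$4) $\gamma_{[x]_r,r}(\underbrace{a_1,\dots,a_1}_{q_1},\dots,\underbrace{a_s,\dots,a_s}_{q_s})=\frac{|\operatorname{Stab}_{q\rhd r}(x)|}{|\operatorname{Stab}_r(x)|}\,\gamma_{[x]_{q\rhd r},q\rhd r}(a_1,\dots,a_s)$ for $q\in\operatorname{Comp}_s(p)$, the quotient being an integer, which is mapped to $\mathbb F$; - ($\gamma$5) $\gamma_{[x]_r,r}(a_0+a_1,a_2,\dots,a_p)=\sum_{l+m=r_1}\ \sum_{[y]\in\Sigma_{r\circ_1(l,m)}\backslash\Omega_r(x)}\gamma_{[y],r\circ_1(l,m)}(a_0,a_1,\dots,a_p)$. Morphisms are the linear maps compatible with all operations. *The functor $P_{\mathcal M}$.* It sends $(A,\beta)$ to $(A,\gamma)$ with $\gamma_{[x]_r,r}=\beta_{\mathcal O_r([x]_r),r}$, where $\mathcal O_r([x]_r)=\sum_{y\in\Omega_r(x)}y\in\mathcal M(n)^{\Sigma_r}$,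 and it sends each morphism to the same underlying linear map. Then the functor $P_{\mathcal M}:\beta(\mathcal M)\to\gamma(\mathcal M)$ is an isomorphism of categories. -/

import Mathlib

universe u v w

namespace GenDivPow

open CategoryTheory Equiv

/-- A composition of `n` into `p` parts: a `p`-tuple of non-negative integers with sum `n`. -/
structure Comp (p n : ℕ) where
  parts : Fin p → ℕ
  sum_eq : ∑ i, parts i = n

namespace Comp

variable {p n s : ℕ}

/-- The identification of the disjoint union of the blocks of sizes `r₁, …, r_p` with `[n]`,
the blocks being consecutive intervals. -/
def blockEquiv (r : Comp p n) : (Σ i : Fin p, Fin (r.parts i)) ≃ Fin n :=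
  finSigmaFinEquiv.trans (finCongr r.sum_eq)

/-- The index of the block which contains a given element of `[n]`. -/
def index (r : Comp p n) (k : Fin n) : Fin p := (r.blockEquiv.symm k).1

/-- The Young subgroup `Σ_{r₁} × ⋯ × Σ_{r_p}` of `Σ_n`: the permutations which preserve
each block. -/
def young (r : Comp p n) : Subgroup (Perm (Fin n)) where
  carrier := {σ | ∀ k, r.index (σ k) = r.index k}
  one_mem' _ := rfl
  mul_mem' {σ τ} hσ hτ k := (hσ (τ k)).trans (hτ k)
  inv_mem' {σ} hσ k := by
    have h := hσ (σ.symm k)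
    rw [Equiv.apply_symm_apply] at h
    exact h.symm

theorem mem_young {r : Comp p n} {σ : Perm (Fin n)} :
    σ ∈ r.young ↔ ∀ k, r.index (σ k) = r.index k := Iff.rfl

/-- The permuted composition `r^ρ = (r_{ρ⁻¹(1)}, …, r_{ρ⁻¹(p)})`. -/
def permute (r : Comp p n) (ρ : Perm (Fin p)) : Comp p n where
  parts i := r.parts (ρ.symm i)
  sum_eq := (Equiv.sum_comp ρ.symm r.parts).trans r.sum_eq

/-- The block permutation `ρ^*`: it sends the `i`-th block of `r` onto the `ρ(i)`-th block
of `r^ρ`, preserving the order inside each block. -/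
def blockPerm (r : Comp p n) (ρ : Perm (Fin p)) : Perm (Fin n) :=
  r.blockEquiv.symm.trans
    ((Equiv.sigmaCongr ρ fun i => finCongr (by simp [permute])).trans
      (r.permute ρ).blockEquiv)

/-- The composition `(0, r₁, …, r_p)`. -/
def zeroCons (r : Comp p n) : Comp (p + 1) n where
  parts := Fin.cons 0 r.parts
  sum_eq := by simp [Fin.sum_univ_succ, r.sum_eq]

/-- The composition `r ∘₁ (l, m) = (l, m, r₂, …, r_p)`, where `l + m = r₁`. -/
def splitFirst (r : Comp (p + 1) n) (l m : ℕ) (h : l + m = r.parts 0) : Comp (p + 2) n where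
  parts := Fin.cons l (Fin.cons m (Fin.tail r.parts))
  sum_eq := by
    have := r.sum_eq
    simp only [Fin.sum_univ_succ, Fin.cons_zero, Fin.cons_succ, Fin.tail] at this ⊢
    omega

/-- The composition `q ▷ r` of `n` into `s` parts, whose `j`-th part is the sum of the `r_i` for
`i` in the `j`-th block of `q`. -/
def merge (q : Comp s p) (r : Comp p n) : Comp s n where
  parts j := ∑ i with q.index i = j, r.parts i
  sum_eq := (Finset.sum_fiberwise _ _ _).trans r.sum_eq

/-! Comparison of the blocks of different compositions. -/

theorem blockEquiv_val (r : Comp p n) (i : Fin p) (j : Fin (r.parts i)) :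
    (r.blockEquiv ⟨i, j⟩ : ℕ) = ∑ i' ∈ Finset.Iio i, r.parts i' + j := by
  simp only [blockEquiv, Equiv.trans_apply, finCongr_apply, Fin.val_cast, finSigmaFinEquiv_apply]
  congr 1
  refine Finset.sum_nbij (Fin.castLE i.2.le) ?_ ?_ ?_ ?_
  · intro a _
    simp [Fin.lt_def]
  · intro a _ b _ h
    simpa using h
  · intro a ha
    simp only [Finset.coe_Iio, Set.mem_Iio] at ha
    exact ⟨⟨a, ha⟩, by simp, by ext; simp⟩
  · intro a _
    rfl

theorem index_spec (r : Comp p n) (k : Fin n) :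
    ∑ i ∈ Finset.Iio (r.index k), r.parts i ≤ k ∧
      (k : ℕ) < ∑ i ∈ Finset.Iio (r.index k), r.parts i + r.parts (r.index k) := by
  have h := r.blockEquiv_val (r.blockEquiv.symm k).1 (r.blockEquiv.symm k).2
  have h2 := (r.blockEquiv.symm k).2.2
  simp only [Sigma.eta, Equiv.apply_symm_apply] at h
  simp only [index]
  omega

theorem sum_Iio_add_le (r : Comp p n) {a b : Fin p} (hab : a < b) :
    ∑ i ∈ Finset.Iio a, r.parts i + r.parts a ≤ ∑ i ∈ Finset.Iio b, r.parts i := by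
  rw [add_comm, ← Finset.sum_insert (by simp)]
  refine Finset.sum_le_sum_of_subset ?_
  intro c hc
  simp only [Finset.mem_insert, Finset.mem_Iio] at hc ⊢
  rcases hc with rfl | hc
  · exact hab
  · exact hc.trans hab

theorem index_eq (r : Comp p n) {k : Fin n} {i : Fin p}
    (h₁ : ∑ i' ∈ Finset.Iio i, r.parts i' ≤ k)
    (h₂ : (k : ℕ) < ∑ i' ∈ Finset.Iio i, r.parts i' + r.parts i) : r.index k = i := by
  obtain ⟨h₃, h₄⟩ := r.index_spec k
  rcases lt_trichotomy (r.index k) i with h | h | h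
  · have := r.sum_Iio_add_le h
    omega
  · exact h
  · have := r.sum_Iio_add_le h
    omega

theorem index_mono (r : Comp p n) : Monotone r.index := by
  intro k l hkl
  by_contra h
  have h : r.index l < r.index k := not_le.mp h
  have h₁ := (r.index_spec k).1
  have h₂ := (r.index_spec l).2
  have := r.sum_Iio_add_le h
  have : (k : ℕ) ≤ l := hkl
  omega

theorem index_of_monotone (r : Comp p n) (r' : Comp s n) (f : Fin p → Fin s) (hf : Monotone f)
    (h : ∀ j, r'.parts j = ∑ i with f i = j, r.parts i) (k : Fin n) :
    r'.index k = f (r.index k) := by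
  obtain ⟨h₁, h₂⟩ := r.index_spec k
  have hS : ∑ j ∈ Finset.Iio (f (r.index k)), r'.parts j =
      ∑ i with f i < f (r.index k), r.parts i := by
    simp only [h]
    rw [← Finset.sum_fiberwise_of_maps_to (s := Finset.univ.filter fun i => f i < f (r.index k))
      (t := Finset.Iio (f (r.index k))) (g := f) (by simp)]
    refine Finset.sum_congr rfl fun j hj => Finset.sum_congr ?_ fun _ _ => rfl
    ext i
    simp only [Finset.mem_Iio] at hj
    simp only [Finset.mem_filter, Finset.mem_univ, true_and]
    constructor
    · rintro rfl
      exact ⟨hj, rfl⟩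
    · exact fun h => h.2
  refine r'.index_eq ?_ ?_
  · rw [hS]
    refine le_trans (Finset.sum_le_sum_of_subset ?_) h₁
    intro i hi
    simp only [Finset.mem_filter, Finset.mem_univ, true_and, Finset.mem_Iio] at hi ⊢
    by_contra hc
    exact absurd (hf (not_lt.mp hc)) (not_le.mpr hi)
  · refine lt_of_lt_of_le h₂ ?_
    rw [hS, h, add_comm, ← Finset.sum_insert (by simp), ← Finset.sum_union]
    · refine Finset.sum_le_sum_of_subset ?_
      intro i hi
      simp only [Finset.mem_insert, Finset.mem_Iio, Finset.mem_union, Finset.mem_filter,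
        Finset.mem_univ, true_and] at hi ⊢
      rcases hi with rfl | hi
      · exact Or.inr rfl
      · exact (hf hi.le).lt_or_eq
    · rw [Finset.disjoint_filter]
      intro i _ h₃ h₄
      exact absurd h₄ h₃.ne

theorem index_merge (q : Comp s p) (r : Comp p n) (k : Fin n) :
    (merge q r).index k = q.index (r.index k) :=
  index_of_monotone _ _ _ q.index_mono (fun _ => rfl) k

theorem index_zeroCons (r : Comp p n) (k : Fin n) : r.zeroCons.index k = (r.index k).succ := by
  refine index_of_monotone r r.zeroCons Fin.succ (Fin.strictMono_succ).monotone ?_ k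
  intro j
  induction j using Fin.cases with
  | zero => simp [zeroCons]
  | succ j => simp [zeroCons, Finset.filter_eq']

theorem index_splitFirst (r : Comp (p + 1) n) (l m : ℕ) (h : l + m = r.parts 0) (k : Fin n) :
    r.index k = Fin.predAbove 0 ((r.splitFirst l m h).index k) := by
  refine index_of_monotone _ _ _ (Fin.predAbove_right_monotone 0) ?_ k
  intro j
  rw [Finset.sum_filter, Fin.sum_univ_succ, Fin.sum_univ_succ]
  induction j using Fin.cases with
  | zero => simp [splitFirst, h]
  | succ j => simp [splitFirst, Fin.tail, Fin.succ_ne_zero, eq_comm]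

theorem index_blockPerm (r : Comp p n) (ρ : Perm (Fin p)) (k : Fin n) :
    (r.permute ρ).index (r.blockPerm ρ k) = ρ (r.index k) := by
  simp only [index, blockPerm, Equiv.trans_apply, Equiv.symm_apply_apply]
  rfl

theorem young_le_merge (q : Comp s p) (r : Comp p n) : r.young ≤ (merge q r).young := by
  intro σ hσ k
  rw [index_merge, index_merge, mem_young.mp hσ]

theorem young_zeroCons (r : Comp p n) : r.zeroCons.young = r.young := by
  ext σ
  simp [mem_young, index_zeroCons]

theorem young_splitFirst_le (r : Comp (p + 1) n) (l m : ℕ) (h : l + m = r.parts 0) :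
    (r.splitFirst l m h).young ≤ r.young := by
  intro σ hσ k
  rw [index_splitFirst r l m h, index_splitFirst r l m h, mem_young.mp hσ]

theorem conj_mem_young (r : Comp p n) (ρ : Perm (Fin p)) {σ : Perm (Fin n)} :
    (r.blockPerm ρ)⁻¹ * σ * r.blockPerm ρ ∈ r.young ↔ σ ∈ (r.permute ρ).young := by
  have hk : ∀ k, r.index ((r.blockPerm ρ).symm k) = ρ.symm ((r.permute ρ).index k) := by
    intro k
    rw [Equiv.eq_symm_apply, ← index_blockPerm, Equiv.apply_symm_apply]
  constructor
  · intro h k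
    have := h ((r.blockPerm ρ).symm k)
    simpa [Perm.mul_apply, hk] using this
  · intro h k
    have := h (r.blockPerm ρ k)
    simp only [Perm.mul_apply, Perm.inv_def, hk, this, index_blockPerm, Equiv.symm_apply_apply]

end Comp

/-- A `Σ`-module: a sequence of representations `M n` of the symmetric groups `Σ_n`. -/
abbrev SigmaModule (F : Type u) [Field F] := ∀ n : ℕ, Rep.{v} F (Perm (Fin n))

section Invariants

variable {F : Type u} [Field F] (M : SigmaModule.{u, v} F) {n : ℕ}

/-- The subspace of the elements of `M n` which are invariant under a subgroup `H` of `Σ_n`. -/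
noncomputable abbrev Inv (H : Subgroup (Perm (Fin n))) : Submodule F (M n) :=
  Representation.invariants ((M n).ρ.comp H.subtype)

variable {M}

theorem mem_Inv {H : Subgroup (Perm (Fin n))} {x : M n} :
    x ∈ Inv M H ↔ ∀ σ ∈ H, (M n).ρ σ x = x := by
  simp [Representation.mem_invariants]

/-- An element invariant under `K` is invariant under any subgroup `H` of `K`. -/
def Inv.restrict {H K : Subgroup (Perm (Fin n))} (h : H ≤ K) (x : Inv M K) : Inv M H :=
  ⟨x, mem_Inv.mpr fun σ hσ => mem_Inv.mp x.2 σ (h hσ)⟩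

/-- If `x` is invariant under `Σ_r`, then `ρ^* · x` is invariant under `Σ_{r^ρ}`. -/
def Inv.permute {p : ℕ} (r : Comp p n) (ρ : Perm (Fin p)) (x : Inv M r.young) :
    Inv M (r.permute ρ).young :=
  ⟨(M n).ρ (r.blockPerm ρ) x, mem_Inv.mpr fun σ hσ => by
    have h := mem_Inv.mp x.2 _ ((r.conj_mem_young ρ).mpr hσ)
    conv_rhs => rw [← h]
    rw [← Module.End.mul_apply, ← Module.End.mul_apply, ← map_mul, ← map_mul]
    congr 2
    group⟩

theorem ρ_eq_of_coset {H K : Subgroup (Perm (Fin n))} (x : Inv M H) {a b : K}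
    (h : (a : K ⧸ H.subgroupOf K) = b) : (M n).ρ a (x : M n) = (M n).ρ b x := by
  have h := mem_Inv.mp x.2 _ (Subgroup.mem_subgroupOf.mp (QuotientGroup.eq.mp h))
  conv_lhs => rw [← h]
  rw [← Module.End.mul_apply, ← map_mul]
  congr 2
  simp

/-- The sum `∑_{σ ∈ K / H} σ · x` for `H ≤ K` and an `H`-invariant element `x`; it is a
`K`-invariant element. By `ρ_eq_of_coset` the terms do not depend on the representatives. -/
noncomputable def Inv.trace {H : Subgroup (Perm (Fin n))} (K : Subgroup (Perm (Fin n)))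
    (x : Inv M H) : Inv M K :=
  ⟨∑ᶠ s : K ⧸ H.subgroupOf K, (M n).ρ (s.out : K) x, mem_Inv.mpr fun σ hσ => by
    rw [← LinearMap.toAddMonoidHom_coe, AddMonoidHom.map_finsum _ (Set.toFinite _)]
    conv_rhs =>
      rw [← finsum_comp_equiv (MulAction.toPerm (⟨σ, hσ⟩ : K) : Perm (K ⧸ H.subgroupOf K))]
    refine finsum_congr fun s => ?_
    rw [LinearMap.toAddMonoidHom_coe, ← Module.End.mul_apply, ← map_mul]
    refine ρ_eq_of_coset x (a := ⟨σ, hσ⟩ * s.out) ?_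
    rw [QuotientGroup.out_eq', MulAction.toPerm_apply, ← smul_eq_mul,
      ← MulAction.Quotient.smul_coe, QuotientGroup.out_eq']⟩

end Invariants

/-- A basis of a `Σ`-module which is stable under the actions of the symmetric groups: for each
`n`, a subset of `M n` which is a basis of `M n` and which is mapped to itself by `Σ_n`. -/
structure StableBasis {F : Type u} [Field F] (M : SigmaModule.{u, v} F) where
  carrier : ∀ n, Set (M n)
  linearIndependent : ∀ n, LinearIndependent F (Subtype.val : carrier n → M n)
  span_eq_top : ∀ n, Submodule.span F (carrier n) = ⊤
  stable : ∀ n (σ : Perm (Fin n)), ∀ x ∈ carrier n, (M n).ρ σ x ∈ carrier n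

namespace StableBasis

variable {F : Type u} [Field F] {M : SigmaModule.{u, v} F} (B : StableBasis M) {n : ℕ}

/-- The action of `Σ_n` on the basis `B(n)`. -/
instance : MulAction (Perm (Fin n)) (B.carrier n) where
  smul σ x := ⟨(M n).ρ σ x, B.stable n σ x x.2⟩
  one_smul x := Subtype.ext (by change (M n).ρ 1 (x : M n) = x; simp)
  mul_smul σ τ x := Subtype.ext (by
    change (M n).ρ (σ * τ) (x : M n) = (M n).ρ σ ((M n).ρ τ x)
    simp)

theorem coe_smul (σ : Perm (Fin n)) (x : B.carrier n) :
    ((σ • x : B.carrier n) : M n) = (M n).ρ σ x := rfl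

/-- The set `H \ B(n)` of the orbits of `B(n)` under a subgroup `H` of `Σ_n`. -/
abbrev Orbits (H : Subgroup (Perm (Fin n))) := MulAction.orbitRel.Quotient H (B.carrier n)

/-- The class `[x]_H` of `x ∈ B(n)` under the action of the subgroup `H` of `Σ_n`. -/
abbrev cls (H : Subgroup (Perm (Fin n))) (x : B.carrier n) : B.Orbits H := Quotient.mk'' x

/-- The sum of the elements of an `H`-orbit of `B(n)`: it is an `H`-invariant element of `M n`. -/
noncomputable def orbitSum (H : Subgroup (Perm (Fin n))) (c : B.Orbits H) : Inv M H :=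
  ⟨∑ᶠ y : c.orbit, ((y : B.carrier n) : M n), mem_Inv.mpr fun σ hσ => by
    have : Finite c.orbit := by
      rw [MulAction.orbitRel.Quotient.orbit_eq_orbit_out c Quotient.out_eq']
      exact Set.finite_range _
    rw [← LinearMap.toAddMonoidHom_coe, AddMonoidHom.map_finsum _ (Set.toFinite _)]
    conv_rhs => rw [← finsum_comp_equiv (MulAction.toPerm (⟨σ, hσ⟩ : H) : Perm c.orbit)]
    rfl⟩

end StableBasis

/-- An object of the category `β(M)`: a vector space `A` with operations `β_{x,r} : A^p → A` for
all compositions `r` of `n` into `p` parts and all `Σ_r`-invariant `x ∈ M(n)`, which satisfy the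
relations (β1) to (β6). -/
structure Beta {F : Type u} [Field F] (M : SigmaModule.{u, v} F) where
  carrier : Type w
  [addCommGroup : AddCommGroup carrier]
  [module : Module F carrier]
  op : ∀ {p n : ℕ} (r : Comp p n), Inv M r.young → (Fin p → carrier) → carrier
  /-- (β1) -/
  op_permute : ∀ {p n : ℕ} (r : Comp p n) (x : Inv M r.young) (ρ : Perm (Fin p))
    (a : Fin p → carrier),
    op r x a = op (r.permute ρ) (Inv.permute r ρ x) (fun i => a (ρ⁻¹ i))
  /-- (β2); the compositions `r` and `(0, r)` have the same Young subgroup. -/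
  op_zeroCons : ∀ {p n : ℕ} (r : Comp p n) (x : Inv M r.zeroCons.young)
    (a₀ : carrier) (a : Fin p → carrier),
    op r.zeroCons x (Fin.cons a₀ a) = op r (Inv.restrict r.young_zeroCons.ge x) a
  /-- (β3) -/
  op_smul_cons : ∀ {p n : ℕ} (r : Comp (p + 1) n) (x : Inv M r.young) (c : F)
    (a₁ : carrier) (a : Fin p → carrier),
    op r x (Fin.cons (c • a₁) a) = c ^ r.parts 0 • op r x (Fin.cons a₁ a)
  /-- (β4) -/
  op_repeat : ∀ {s p n : ℕ} (r : Comp p n) (q : Comp s p) (x : Inv M r.young)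
    (a : Fin s → carrier),
    op r x (fun i => a (q.index i)) = op (q.merge r) (Inv.trace (q.merge r).young x) a
  /-- (β5) -/
  op_add_cons : ∀ {p n : ℕ} (r : Comp (p + 1) n) (x : Inv M r.young)
    (a₀ a₁ : carrier) (a : Fin p → carrier),
    op r x (Fin.cons (a₀ + a₁) a) =
      ∑ lm : Finset.HasAntidiagonal.antidiagonal (r.parts 0),
        op (r.splitFirst lm.1.1 lm.1.2 (Finset.HasAntidiagonal.mem_antidiagonal.mp lm.2))
          (Inv.restrict (r.young_splitFirst_le _ _ _) x) (Fin.cons a₀ (Fin.cons a₁ a))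
  /-- (β6) -/
  op_linear : ∀ {p n : ℕ} (r : Comp p n) (c : F) (x y : Inv M r.young) (a : Fin p → carrier),
    op r (c • x + y) a = c • op r x a + op r y a

/-- An object of the category `γ(M)`, for a `Σ`-module `M` with a stable basis `B`: a vector space
`A` with operations `γ_{[x],r} : A^p → A` for all compositions `r` of `n` into `p` parts and all
`Σ_r`-orbits `[x]` in `B(n)`, which satisfy the relations (γ1) to (γ5). -/
structure Gamma {F : Type u} [Field F] {M : SigmaModule.{u, v} F} (B : StableBasis M) where
  carrier : Type w
  [addCommGroup : AddCommGroup carrier]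
  [module : Module F carrier]
  op : ∀ {p n : ℕ} (r : Comp p n), B.Orbits r.young → (Fin p → carrier) → carrier
  /-- (γ1) -/
  op_permute : ∀ {p n : ℕ} (r : Comp p n) (x : B.carrier n) (ρ : Perm (Fin p))
    (a : Fin p → carrier),
    op r (B.cls r.young x) a =
      op (r.permute ρ) (B.cls (r.permute ρ).young (r.blockPerm ρ • x)) (fun i => a (ρ⁻¹ i))
  /-- (γ2) -/
  op_zeroCons : ∀ {p n : ℕ} (r : Comp p n) (x : B.carrier n) (a₀ : carrier) (a : Fin p → carrier),
    op r.zeroCons (B.cls r.zeroCons.young x) (Fin.cons a₀ a) = op r (B.cls r.young x) a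
  /-- (γ3) -/
  op_smul_cons : ∀ {p n : ℕ} (r : Comp (p + 1) n) (x : B.carrier n) (c : F)
    (a₁ : carrier) (a : Fin p → carrier),
    op r (B.cls r.young x) (Fin.cons (c • a₁) a) =
      c ^ r.parts 0 • op r (B.cls r.young x) (Fin.cons a₁ a)
  /-- (γ4); the stabiliser of `x` in `Σ_r` is a subgroup of the one in `Σ_{q ▷ r}`, hence the
  quotient of their orders is an integer, which is then mapped to `F`. -/
  op_repeat : ∀ {s p n : ℕ} (r : Comp p n) (q : Comp s p) (x : B.carrier n) (a : Fin s → carrier),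
    op r (B.cls r.young x) (fun i => a (q.index i)) =
      ((Nat.card (MulAction.stabilizer (q.merge r).young x) /
        Nat.card (MulAction.stabilizer r.young x) : ℕ) : F) •
          op (q.merge r) (B.cls (q.merge r).young x) a
  /-- (γ5); the inner sum is over the orbits of `Σ_{r ∘₁ (l, m)}` in the `Σ_r`-orbit of `x`. -/
  op_add_cons : ∀ {p n : ℕ} (r : Comp (p + 1) n) (x : B.carrier n)
    (a₀ a₁ : carrier) (a : Fin p → carrier),
    op r (B.cls r.young x) (Fin.cons (a₀ + a₁) a) =
      ∑ lm : Finset.HasAntidiagonal.antidiagonal (r.parts 0),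
        ∑ᶠ c ∈ B.cls
            (r.splitFirst lm.1.1 lm.1.2 (Finset.HasAntidiagonal.mem_antidiagonal.mp lm.2)).young ''
              MulAction.orbit r.young x,
          op (r.splitFirst lm.1.1 lm.1.2 (Finset.HasAntidiagonal.mem_antidiagonal.mp lm.2)) c
            (Fin.cons a₀ (Fin.cons a₁ a))

attribute [instance] Beta.addCommGroup Beta.module Gamma.addCommGroup Gamma.module

namespace Beta

variable {F : Type u} [Field F] {M : SigmaModule.{u, v} F}

/-- A morphism of `β(M)`: a linear map compatible with all the operations. -/
@[ext]
structure Hom (X Y : Beta.{u, v, w} M) where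
  toLinearMap : X.carrier →ₗ[F] Y.carrier
  map_op : ∀ {p n : ℕ} (r : Comp p n) (x : Inv M r.young) (a : Fin p → X.carrier),
    toLinearMap (X.op r x a) = Y.op r x (fun i => toLinearMap (a i))

instance : Category (Beta.{u, v, w} M) where
  Hom X Y := Hom X Y
  id X := ⟨LinearMap.id, fun _ _ _ => rfl⟩
  comp f g := ⟨g.toLinearMap ∘ₗ f.toLinearMap, fun r x a => by
    simp [f.map_op, g.map_op]⟩

end Beta

namespace Gamma

variable {F : Type u} [Field F] {M : SigmaModule.{u, v} F} {B : StableBasis M}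

/-- A morphism of `γ(M)`: a linear map compatible with all the operations. -/
@[ext]
structure Hom (X Y : Gamma.{u, v, w} B) where
  toLinearMap : X.carrier →ₗ[F] Y.carrier
  map_op : ∀ {p n : ℕ} (r : Comp p n) (c : B.Orbits r.young) (a : Fin p → X.carrier),
    toLinearMap (X.op r c a) = Y.op r c (fun i => toLinearMap (a i))

instance : Category (Gamma.{u, v, w} B) where
  Hom X Y := Hom X Y
  id X := ⟨LinearMap.id, fun _ _ _ => rfl⟩
  comp f g := ⟨g.toLinearMap ∘ₗ f.toLinearMap, fun r x a => by
    simp [f.map_op, g.map_op]⟩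

end Gamma

/-! Sums over orbits, needed to see that the functor `P_M` is well defined. -/

section OrbitSums

variable {V : Type*} [AddCommGroup V] {G X : Type*} [Group G] [MulAction G X]

theorem sum_group_eq_sum_coset [Fintype G] (L : Subgroup G) [Fintype L] [Fintype (G ⧸ L)]
    (g : G → V) : ∑ k, g k = ∑ s : G ⧸ L, ∑ l : L, g (s.out * l) := by
  rw [← Fintype.sum_prod_type']
  symm
  refine Fintype.sum_bijective (fun sl : (G ⧸ L) × L => sl.1.out * (sl.2 : G)) ⟨?_, ?_⟩ _ _
    fun _ => rfl
  · rintro ⟨s, l⟩ ⟨s', l'⟩ h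
    have hm := congrArg (fun k : G => (k : G ⧸ L)) h
    have hs : s = s' := by simpa using hm
    subst hs
    have hl : (l : G) = l' := by simpa using h
    rw [Subtype.ext hl]
  · intro k
    refine ⟨⟨(k : G ⧸ L), ⟨(k : G ⧸ L).out⁻¹ * k, ?_⟩⟩, by simp⟩
    exact QuotientGroup.eq.mp (QuotientGroup.out_eq' _)

theorem sum_group_eq_card_smul [Fintype G] (x : X) [Fintype (MulAction.orbit G x)] (f : X → V) :
    ∑ g : G, f (g • x) =
      Nat.card (MulAction.stabilizer G x) • ∑ y : MulAction.orbit G x, f y := by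
  classical
  rw [sum_group_eq_sum_coset (MulAction.stabilizer G x), Finset.smul_sum]
  symm
  refine Fintype.sum_equiv (MulAction.orbitEquivQuotientStabilizer G x) _ _ fun y => ?_
  have h : ((MulAction.orbitEquivQuotientStabilizer G x y).out • x : X) = y := by
    rw [← MulAction.orbitEquivQuotientStabilizer_symm_apply, QuotientGroup.out_eq',
      Equiv.symm_apply_apply]
  have h' : ∀ l : MulAction.stabilizer G x,
      ((MulAction.orbitEquivQuotientStabilizer G x y).out * (l : G)) • x = (y : X) := by
    intro l
    rw [mul_smul, l.2, h]
  simp [h', Nat.card_eq_fintype_card]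

theorem sum_coset_orbit_free [Finite G] {H K : Subgroup G} (h : H ≤ K) (x : X)
    [Fintype (K ⧸ H.subgroupOf K)] [Fintype (MulAction.orbit H x)]
    [Fintype (MulAction.orbit K x)] :
    ∑ s : K ⧸ H.subgroupOf K, ∑ y : MulAction.orbit H x,
        Finsupp.single ((s.out : G) • (y : X)) (1 : ℤ) =
      (Nat.card (MulAction.stabilizer K x) / Nat.card (MulAction.stabilizer H x)) •
        ∑ z : MulAction.orbit K x, Finsupp.single (z : X) (1 : ℤ) := by
  classical
  have := Fintype.ofFinite G
  have hd : Nat.card (MulAction.stabilizer H x) ∣ Nat.card (MulAction.stabilizer K x) := by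
    let φ : MulAction.stabilizer H x →* MulAction.stabilizer K x :=
      { toFun := fun a => ⟨⟨a.1.1, h a.1.2⟩, a.2⟩
        map_one' := rfl
        map_mul' := fun _ _ => rfl }
    refine Subgroup.card_dvd_of_injective φ ?_
    intro a b hab
    have : (a.1.1 : G) = b.1.1 := congrArg (fun c : MulAction.stabilizer K x => (c.1.1 : G)) hab
    exact Subtype.ext (Subtype.ext this)
  have hpos : Nat.card (MulAction.stabilizer H x) ≠ 0 := Nat.card_pos.ne'
  have key : Nat.card (MulAction.stabilizer H x) •
      (∑ s : K ⧸ H.subgroupOf K, ∑ y : MulAction.orbit H x,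
        Finsupp.single ((s.out : G) • (y : X)) (1 : ℤ)) =
      Nat.card (MulAction.stabilizer K x) •
        ∑ z : MulAction.orbit K x, Finsupp.single (z : X) (1 : ℤ) := by
    rw [← sum_group_eq_card_smul x (fun z => Finsupp.single z (1 : ℤ)),
      sum_group_eq_sum_coset (H.subgroupOf K), Finset.smul_sum]
    refine Finset.sum_congr rfl fun s _ => ?_
    rw [← sum_group_eq_card_smul x (fun z => Finsupp.single ((s.out : G) • z) (1 : ℤ))]
    refine (Fintype.sum_equiv (Subgroup.subgroupOfEquivOfLe h).toEquiv _ _ fun l => ?_).symm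
    rw [mul_smul]
    rfl
  rw [← smul_right_inj hpos, key, smul_smul, Nat.mul_div_cancel' hd]

theorem sum_coset_orbit [Finite G] {H K : Subgroup G} (h : H ≤ K) (x : X)
    [Fintype (K ⧸ H.subgroupOf K)] [Fintype (MulAction.orbit H x)]
    [Fintype (MulAction.orbit K x)] (f : X → V) :
    ∑ s : K ⧸ H.subgroupOf K, ∑ y : MulAction.orbit H x, f ((s.out : G) • (y : X)) =
      (Nat.card (MulAction.stabilizer K x) / Nat.card (MulAction.stabilizer H x)) •
        ∑ z : MulAction.orbit K x, f z := by
  have := congrArg (Finsupp.liftAddHom fun z : X => (zmultiplesHom V (f z) : ℤ →+ V))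
    (sum_coset_orbit_free h x)
  simpa [map_sum, map_nsmul] using this

end OrbitSums

namespace StableBasis

variable {F : Type u} [Field F] {M : SigmaModule.{u, v} F} (B : StableBasis M) {n : ℕ}

instance (H : Subgroup (Perm (Fin n))) (x : B.carrier n) : Finite (MulAction.orbit H x) :=
  Set.finite_range _

theorem coe_orbitSum (H : Subgroup (Perm (Fin n))) (x : B.carrier n)
    [Fintype (MulAction.orbit H x)] :
    (B.orbitSum H (B.cls H x) : M n) = ∑ y : MulAction.orbit H x, ((y : B.carrier n) : M n) :=
  finsum_eq_sum_of_fintype fun y : MulAction.orbit H x => ((y : B.carrier n) : M n)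

theorem permute_orbitSum {p : ℕ} (r : Comp p n) (ρ : Perm (Fin p)) (x : B.carrier n) :
    Inv.permute r ρ (B.orbitSum r.young (B.cls r.young x)) =
      B.orbitSum (r.permute ρ).young (B.cls (r.permute ρ).young (r.blockPerm ρ • x)) := by
  classical
  have := Fintype.ofFinite (MulAction.orbit r.young x)
  have := Fintype.ofFinite (MulAction.orbit (r.permute ρ).young (r.blockPerm ρ • x))
  apply Subtype.ext
  change (M n).ρ (r.blockPerm ρ) _ = _
  rw [coe_orbitSum, coe_orbitSum, map_sum]
  have hmem : ∀ y ∈ MulAction.orbit r.young x,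
      r.blockPerm ρ • y ∈ MulAction.orbit (r.permute ρ).young (r.blockPerm ρ • x) := by
    rintro _ ⟨σ, rfl⟩
    refine ⟨⟨r.blockPerm ρ * σ * (r.blockPerm ρ)⁻¹, ?_⟩, ?_⟩
    · rw [← r.conj_mem_young]
      convert σ.2 using 1
      group
    · simp [Subgroup.smul_def, mul_smul]
  refine Fintype.sum_bijective (fun y : MulAction.orbit r.young x =>
    (⟨r.blockPerm ρ • y.1, hmem y.1 y.2⟩ :
      MulAction.orbit (r.permute ρ).young (r.blockPerm ρ • x))) ⟨?_, ?_⟩ _ _ fun y => rfl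
  · intro y z hyz
    exact Subtype.ext (MulAction.injective (r.blockPerm ρ) (congrArg Subtype.val hyz))
  · rintro ⟨_, ⟨σ, rfl⟩⟩
    refine ⟨⟨(r.blockPerm ρ)⁻¹ • σ • r.blockPerm ρ • x,
      ⟨⟨_, (r.conj_mem_young ρ).mpr σ.2⟩, ?_⟩⟩, ?_⟩
    · simp [Subgroup.smul_def, mul_smul]
    · simp

theorem restrict_orbitSum_of_eq {H K : Subgroup (Perm (Fin n))} (h : H = K) (x : B.carrier n) :
    Inv.restrict h.le (B.orbitSum K (B.cls K x)) = B.orbitSum H (B.cls H x) := by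
  subst h
  rfl

theorem trace_orbitSum {H K : Subgroup (Perm (Fin n))} (h : H ≤ K) (x : B.carrier n) :
    Inv.trace K (B.orbitSum H (B.cls H x)) =
      ((Nat.card (MulAction.stabilizer K x) / Nat.card (MulAction.stabilizer H x) : ℕ) : F) •
        B.orbitSum K (B.cls K x) := by
  classical
  have := Fintype.ofFinite (K ⧸ H.subgroupOf K)
  have := Fintype.ofFinite (MulAction.orbit H x)
  have := Fintype.ofFinite (MulAction.orbit K x)
  apply Subtype.ext
  rw [Submodule.coe_smul, coe_orbitSum, Nat.cast_smul_eq_nsmul,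
    ← sum_coset_orbit h x (fun z => (z : M n))]
  simp only [Inv.trace, finsum_eq_sum_of_fintype, coe_orbitSum, map_sum]
  rfl

theorem restrict_orbitSum {H K : Subgroup (Perm (Fin n))} (h : H ≤ K) (x : B.carrier n) :
    Inv.restrict h (B.orbitSum K (B.cls K x)) =
      ∑ᶠ c ∈ B.cls H '' MulAction.orbit K x, B.orbitSum H c := by
  have hfin : (B.cls H '' MulAction.orbit K x).Finite := (Set.toFinite _).image _
  have hU : MulAction.orbit K x = ⋃ c ∈ B.cls H '' MulAction.orbit K x, c.orbit := by
    ext y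
    simp only [Set.mem_iUnion, exists_prop, Set.exists_mem_image,
      MulAction.orbitRel.Quotient.orbit_mk]
    constructor
    · exact fun hy => ⟨y, hy, MulAction.mem_orbit_self y⟩
    · rintro ⟨_, ⟨k, rfl⟩, ⟨g, rfl⟩⟩
      exact ⟨⟨g, h g.2⟩ * k, mul_smul _ _ _⟩
  apply Subtype.ext
  refine Eq.trans ?_ ((Inv M H).subtype.toAddMonoidHom.map_finsum_mem (B.orbitSum H) hfin).symm
  change ∑ᶠ y : MulAction.orbit K x, ((y : B.carrier n) : M n) =
    ∑ᶠ c ∈ B.cls H '' MulAction.orbit K x, ∑ᶠ y : c.orbit, ((y : B.carrier n) : M n)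
  simp only [finsum_set_coe_eq_finsum_mem]
  conv_lhs => rw [hU]
  refine finsum_mem_biUnion ?_ hfin ?_
  · intro c _ d _ hcd
    refine Set.disjoint_left.mpr fun y hc hd => hcd ?_
    rw [MulAction.orbitRel.Quotient.mem_orbit] at hc hd
    exact hc.symm.trans hd
  · rintro _ ⟨y, _, rfl⟩
    exact Set.finite_range _

end StableBasis

namespace Beta

variable {F : Type u} [Field F] {M : SigmaModule.{u, v} F}

/-- The operations of an object of `β(M)`, as linear maps in the parameter `x ∈ M(n)^{Σ_r}`. -/
def opLin (X : Beta.{u, v, w} M) {p n : ℕ} (r : Comp p n) (a : Fin p → X.carrier) :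
    Inv M r.young →ₗ[F] X.carrier :=
  have h0 : X.op r 0 a = 0 := by simpa using X.op_linear r 1 0 0 a
  { toFun := fun x => X.op r x a
    map_add' := fun x y => by simpa using X.op_linear r 1 x y a
    map_smul' := fun c x => by simpa [h0] using X.op_linear r c x 0 a }

theorem opLin_apply (X : Beta.{u, v, w} M) {p n : ℕ} (r : Comp p n) (a : Fin p → X.carrier)
    (x : Inv M r.young) : X.opLin r a x = X.op r x a := rfl

end Beta

/-- The object `P_M(A, β) = (A, γ)` of `γ(M)`, where `γ_{[x],r} = β_{O([x]),r}` and `O([x])` is the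
sum of the elements of the `Σ_r`-orbit `[x]`. -/
noncomputable def Beta.toGamma {F : Type u} [Field F] {M : SigmaModule.{u, v} F}
    (B : StableBasis M) (X : Beta.{u, v, w} M) : Gamma.{u, v, w} B where
  carrier := X.carrier
  op r c a := X.op r (B.orbitSum r.young c) a
  op_permute r x ρ a := by
    rw [X.op_permute r _ ρ, B.permute_orbitSum]
  op_zeroCons r x a₀ a := by
    rw [X.op_zeroCons, B.restrict_orbitSum_of_eq r.young_zeroCons.symm]
  op_smul_cons r x c a₁ a := X.op_smul_cons r _ c a₁ a
  op_repeat r q x a := by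
    rw [X.op_repeat, B.trace_orbitSum (Comp.young_le_merge q r), ← X.opLin_apply, map_smul]
    rfl
  op_add_cons {p n} r x a₀ a₁ a := by
    rw [X.op_add_cons]
    refine Finset.sum_congr rfl fun lm _ => ?_
    rw [B.restrict_orbitSum, ← X.opLin_apply, ← LinearMap.toAddMonoidHom_coe,
      AddMonoidHom.map_finsum_mem _ _ ((Set.toFinite (MulAction.orbit r.young x)).image _)]
    rfl

/-- The functor `P_M : β(M) ⥤ γ(M)`; it does not change the underlying linear maps. -/
noncomputable def functorP {F : Type u} [Field F] {M : SigmaModule.{u, v} F}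
    (B : StableBasis M) : Beta.{u, v, w} M ⥤ Gamma.{u, v, w} B where
  obj X := X.toGamma B
  map f := ⟨f.toLinearMap, fun r _ a => f.map_op r _ a⟩

end GenDivPow

/-!
The sums over the `H`-orbits of a stable basis of `M(n)` form a basis of `M(n)^H`. By (β6) the
operation `β_{x,r}` is linear in `x`, so it is determined by its values on the orbit sums, i.e. by
the operations `γ`, and conversely `γ` extends linearly to all invariants. Both sides of each of the
relations (β1) to (β5) are linear in `x`, because permuting blocks, restriction and trace are; on
orbit sums these relations are (γ1) to (γ5), by the formulas which show that `P_M` is well defined.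
-/

namespace GenDivPow

open CategoryTheory Equiv

section PermutedBasis

open MulAction (orbitRel)

variable {k G V ι : Type*} [Group G] [MulAction G ι]

instance [Finite G] (c : orbitRel.Quotient G ι) : Finite c.orbit := by
  rw [orbitRel.Quotient.orbit_eq_orbit_out c Quotient.out_eq']
  exact Set.finite_range _

section Semiring

variable [Semiring k] [AddCommMonoid V] [Module k V] {ρ : Representation k G V}
  {b : Module.Basis ι k V}

theorem repr_apply_smul (hρ : ∀ g i, ρ g (b i) = b (g • i)) (g : G) (v : V) (i : ι) :
    b.repr (ρ g v) (g • i) = b.repr v i := by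
  classical
  have h : Finsupp.lapply (g • i) ∘ₗ b.repr ∘ₗ ρ g = Finsupp.lapply i ∘ₗ b.repr.toLinearMap :=
    b.ext fun j => by simp [hρ, Finsupp.single_apply]
  exact LinearMap.congr_fun h v

theorem repr_finsum_orbit (c : orbitRel.Quotient G ι) [Finite c.orbit] (i : ι) :
    b.repr (∑ᶠ j : c.orbit, b j) i = Finsupp.single c 1 (Quotient.mk'' i) := by
  classical
  have := Fintype.ofFinite c.orbit
  have hi : c = Quotient.mk'' i ↔ ∃ j : c.orbit, (j : ι) = i := by
    simp [orbitRel.Quotient.mem_orbit, eq_comm]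
  rw [finsum_eq_sum_of_fintype, map_sum, Finsupp.finsetSum_apply, Finsupp.single_apply]
  simp only [Module.Basis.repr_self, Finsupp.single_apply, hi]
  split_ifs with h
  · obtain ⟨j, rfl⟩ := h
    simp [Subtype.val_inj]
  · exact Finset.sum_eq_zero fun j _ => if_neg fun hj => h ⟨j, hj⟩

theorem repr_linearCombination_finsum_orbit [∀ c : orbitRel.Quotient G ι, Finite c.orbit]
    (a : orbitRel.Quotient G ι →₀ k) (i : ι) :
    b.repr (Finsupp.linearCombination k (fun c => ∑ᶠ j : c.orbit, b j) a) i =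
      a (Quotient.mk'' i) := by
  classical
  simp +contextual [Finsupp.linearCombination_apply, Finsupp.sum, repr_finsum_orbit,
    Finsupp.single_apply]

end Semiring

variable [CommRing k] [AddCommGroup V] [Module k V] {ρ : Representation k G V}
  {b : Module.Basis ι k V}

theorem mem_invariants_iff_repr_smul (hρ : ∀ g i, ρ g (b i) = b (g • i)) {v : V} :
    v ∈ ρ.invariants ↔ ∀ (g : G) i, b.repr v (g • i) = b.repr v i := by
  refine ⟨fun hv g i => ?_, fun h g => b.ext_elem fun i => ?_⟩
  · rw [← repr_apply_smul hρ g v i, hv g]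
  · obtain ⟨i, rfl⟩ := MulAction.surjective g i
    rw [repr_apply_smul hρ, h]

theorem repr_out_mk_of_mem_invariants (hρ : ∀ g i, ρ g (b i) = b (g • i)) {v : V}
    (hv : v ∈ ρ.invariants) (i : ι) :
    b.repr v (Quotient.out (Quotient.mk'' i : orbitRel.Quotient G ι)) = b.repr v i := by
  obtain ⟨g, hg⟩ := Quotient.eq''.mp (Quotient.out_eq' (Quotient.mk'' i : orbitRel.Quotient G ι))
  rw [← hg]
  exact (mem_invariants_iff_repr_smul hρ).mp hv g i

theorem finsum_orbit_mem_invariants (hρ : ∀ g i, ρ g (b i) = b (g • i))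
    (c : orbitRel.Quotient G ι) [Finite c.orbit] : ∑ᶠ j : c.orbit, b j ∈ ρ.invariants := by
  refine (mem_invariants_iff_repr_smul hρ).mpr fun g i => ?_
  have hg : (Quotient.mk'' (g • i) : orbitRel.Quotient G ι) = Quotient.mk'' i :=
    Quotient.sound' ⟨g, rfl⟩
  rw [repr_finsum_orbit, repr_finsum_orbit, hg]

/-- The basis of the invariants of a representation formed by the orbit sums of a permuted basis
with finite orbits; the coordinate at an orbit is read off at a representative. -/
noncomputable def invariantsBasis (hρ : ∀ g i, ρ g (b i) = b (g • i))
    [∀ c : orbitRel.Quotient G ι, Finite c.orbit] :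
    Module.Basis (orbitRel.Quotient G ι) k ρ.invariants :=
  let coords : ρ.invariants →ₗ[k] orbitRel.Quotient G ι →₀ k :=
    Finsupp.lcomapDomain Quotient.out Quotient.out_injective ∘ₗ b.repr ∘ₗ ρ.invariants.subtype
  let combine : (orbitRel.Quotient G ι →₀ k) →ₗ[k] ρ.invariants :=
    Finsupp.linearCombination k fun c => ⟨_, finsum_orbit_mem_invariants hρ c⟩
  have coords_apply (v : ρ.invariants) (c : orbitRel.Quotient G ι) :
      coords v c = b.repr v c.out := by
    simp [coords]
  have repr_combine (a : orbitRel.Quotient G ι →₀ k) (i : ι) :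
      b.repr (combine a) i = a (Quotient.mk'' i) := by
    rw [← repr_linearCombination_finsum_orbit (b := b) a i]
    exact congrArg (b.repr · i) (Finsupp.apply_linearCombination k ρ.invariants.subtype _ a)
  .ofRepr <| .ofLinearMap coords combine
    (LinearMap.ext fun a => Finsupp.ext fun c =>
      calc
        coords (combine a) c = a (Quotient.mk'' c.out) := by rw [coords_apply, repr_combine]
        _ = a c := congrArg a (Quotient.out_eq' c))
    (LinearMap.ext fun v => Subtype.ext <| b.ext_elem fun i =>
      calc
        b.repr (combine (coords v)) i = b.repr v (Quotient.mk'' i).out := by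
          rw [repr_combine, coords_apply]
        _ = b.repr v i := repr_out_mk_of_mem_invariants hρ v.2 i)

theorem coe_invariantsBasis (hρ : ∀ g i, ρ g (b i) = b (g • i))
    [∀ c : orbitRel.Quotient G ι, Finite c.orbit] (c : orbitRel.Quotient G ι) :
    (invariantsBasis hρ c : V) = ∑ᶠ j : c.orbit, b j := by
  simp [invariantsBasis]

end PermutedBasis

section InvariantsLinear

variable {F : Type u} [Field F] {M : SigmaModule.{u, v} F} {n : ℕ}

/-- The restriction `Inv.restrict` of invariance to a smaller subgroup, as a linear map. -/
@[simps]
def Inv.restrictₗ {H K : Subgroup (Perm (Fin n))} (h : H ≤ K) : Inv M K →ₗ[F] Inv M H where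
  toFun := Inv.restrict h
  map_add' _ _ := rfl
  map_smul' _ _ := rfl

/-- The action `Inv.permute` of a block permutation on invariants, as a linear map. -/
@[simps]
def Inv.permuteₗ {p : ℕ} (r : Comp p n) (ρ : Perm (Fin p)) :
    Inv M r.young →ₗ[F] Inv M (r.permute ρ).young where
  toFun := Inv.permute r ρ
  map_add' x y := Subtype.ext (map_add ((M n).ρ (r.blockPerm ρ)) (x : M n) y)
  map_smul' c x := Subtype.ext (map_smul ((M n).ρ (r.blockPerm ρ)) c (x : M n))

/-- The relative trace `Inv.trace`, as a linear map. -/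
@[simps]
noncomputable def Inv.traceₗ (H K : Subgroup (Perm (Fin n))) : Inv M H →ₗ[F] Inv M K where
  toFun := Inv.trace K
  map_add' x y := Subtype.ext (by
    simp [Inv.trace, finsum_add_distrib (Set.toFinite _) (Set.toFinite _)])
  map_smul' c x := Subtype.ext (by
    simp [Inv.trace, smul_finsum' c (Set.toFinite _)])

end InvariantsLinear

namespace StableBasis

variable {F : Type u} [Field F] {M : SigmaModule.{u, v} F} (B : StableBasis M) {n : ℕ}

/-- The basis of `M n` with underlying set `B.carrier n`, as a `Module.Basis`. -/
noncomputable def basis (n : ℕ) : Module.Basis (B.carrier n) F (M n) :=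
  .mk (B.linearIndependent n) (by simp [B.span_eq_top n])

theorem basis_apply (x : B.carrier n) : B.basis n x = (x : M n) := by
  simp [basis]

theorem ρ_basis (H : Subgroup (Perm (Fin n))) (σ : H) (x : B.carrier n) :
    (M n).ρ.comp H.subtype σ (B.basis n x) = B.basis n (σ • x) := by
  simp [basis_apply, Subgroup.smul_def, coe_smul]

/-- The basis of the `H`-invariants of `M n` formed by the sums of the `H`-orbits of `B(n)`. -/
noncomputable def orbitSumBasis (H : Subgroup (Perm (Fin n))) :
    Module.Basis (B.Orbits H) F (Inv M H) :=
  invariantsBasis (B.ρ_basis H)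

theorem orbitSumBasis_apply (H : Subgroup (Perm (Fin n))) (c : B.Orbits H) :
    B.orbitSumBasis H c = B.orbitSum H c :=
  Subtype.ext <| (coe_invariantsBasis (B.ρ_basis H) c).trans <| by
    simp only [basis_apply]
    rfl

theorem linearMap_ext_orbitSum {V : Type*} [AddCommGroup V] [Module F V]
    {H : Subgroup (Perm (Fin n))} {f g : Inv M H →ₗ[F] V}
    (h : ∀ x : B.carrier n, f (B.orbitSum H (B.cls H x)) = g (B.orbitSum H (B.cls H x))) :
    f = g :=
  (B.orbitSumBasis H).ext <| Quotient.ind' fun x => by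
    simpa only [orbitSumBasis_apply] using h x

theorem map_restrict_orbitSum {V : Type*} [AddCommGroup V] [Module F V]
    {H K : Subgroup (Perm (Fin n))} (h : H ≤ K) (x : B.carrier n) (f : Inv M H →ₗ[F] V) :
    f (Inv.restrict h (B.orbitSum K (B.cls K x))) =
      ∑ᶠ c ∈ B.cls H '' MulAction.orbit K x, f (B.orbitSum H c) := by
  rw [B.restrict_orbitSum h]
  exact f.toAddMonoidHom.map_finsum_mem _ ((Set.toFinite (MulAction.orbit K x)).image _)

end StableBasis

attribute [ext] Beta Gamma

namespace Gamma

variable {F : Type u} [Field F] {M : SigmaModule.{u, v} F} {B : StableBasis M}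

section OpLin

variable (X : Gamma.{u, v, w} B) {p n : ℕ}

/-- The operations of an object of `γ(M)`, extended linearly from the orbit sums to all
invariants. -/
noncomputable def opLin (r : Comp p n) (a : Fin p → X.carrier) : Inv M r.young →ₗ[F] X.carrier :=
  (B.orbitSumBasis r.young).constr F fun c => X.op r c a

theorem opLin_orbitSum (r : Comp p n) (a : Fin p → X.carrier) (c : B.Orbits r.young) :
    X.opLin r a (B.orbitSum r.young c) = X.op r c a := by
  rw [← B.orbitSumBasis_apply, opLin, Module.Basis.constr_basis]

theorem opLin_permute (r : Comp p n) (ρ : Perm (Fin p)) (a : Fin p → X.carrier) :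
    X.opLin r a = X.opLin (r.permute ρ) (fun i => a (ρ⁻¹ i)) ∘ₗ Inv.permuteₗ r ρ :=
  B.linearMap_ext_orbitSum fun x => by
    rw [LinearMap.comp_apply, Inv.permuteₗ_apply, B.permute_orbitSum, opLin_orbitSum,
      opLin_orbitSum, X.op_permute r x ρ]

theorem opLin_zeroCons (r : Comp p n) (a₀ : X.carrier) (a : Fin p → X.carrier) :
    X.opLin r.zeroCons (Fin.cons a₀ a) = X.opLin r a ∘ₗ Inv.restrictₗ r.young_zeroCons.ge :=
  B.linearMap_ext_orbitSum fun x => by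
    rw [LinearMap.comp_apply, Inv.restrictₗ_apply,
      B.restrict_orbitSum_of_eq r.young_zeroCons.symm, opLin_orbitSum, opLin_orbitSum,
      X.op_zeroCons]

theorem opLin_smul_cons (r : Comp (p + 1) n) (c : F) (a₁ : X.carrier) (a : Fin p → X.carrier) :
    X.opLin r (Fin.cons (c • a₁) a) = c ^ r.parts 0 • X.opLin r (Fin.cons a₁ a) :=
  B.linearMap_ext_orbitSum fun x => by
    rw [LinearMap.smul_apply, opLin_orbitSum, opLin_orbitSum, X.op_smul_cons]

theorem opLin_repeat {s : ℕ} (r : Comp p n) (q : Comp s p) (a : Fin s → X.carrier) :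
    X.opLin r (fun i => a (q.index i)) =
      X.opLin (q.merge r) a ∘ₗ Inv.traceₗ r.young (q.merge r).young :=
  B.linearMap_ext_orbitSum fun x => by
    rw [LinearMap.comp_apply, Inv.traceₗ_apply, B.trace_orbitSum (Comp.young_le_merge q r),
      map_smul, opLin_orbitSum, opLin_orbitSum, X.op_repeat]

theorem opLin_add_cons (r : Comp (p + 1) n) (a₀ a₁ : X.carrier) (a : Fin p → X.carrier) :
    X.opLin r (Fin.cons (a₀ + a₁) a) =
      ∑ lm : Finset.HasAntidiagonal.antidiagonal (r.parts 0),
        X.opLin (r.splitFirst lm.1.1 lm.1.2 (Finset.HasAntidiagonal.mem_antidiagonal.mp lm.2))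
          (Fin.cons a₀ (Fin.cons a₁ a)) ∘ₗ Inv.restrictₗ (r.young_splitFirst_le _ _ _) :=
  B.linearMap_ext_orbitSum fun x => by
    simp only [LinearMap.sum_apply, LinearMap.comp_apply, Inv.restrictₗ_apply,
      B.map_restrict_orbitSum, opLin_orbitSum, X.op_add_cons]

end OpLin

/-- The object of `β(M)` whose operations are the linear extensions of those of an object
of `γ(M)`. -/
noncomputable def toBeta (X : Gamma.{u, v, w} B) : Beta.{u, v, w} M where
  carrier := X.carrier
  op r x a := X.opLin r a x
  op_permute r x ρ a := LinearMap.congr_fun (X.opLin_permute r ρ a) x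
  op_zeroCons r x a₀ a := LinearMap.congr_fun (X.opLin_zeroCons r a₀ a) x
  op_smul_cons r x c a₁ a := LinearMap.congr_fun (X.opLin_smul_cons r c a₁ a) x
  op_repeat r q x a := LinearMap.congr_fun (X.opLin_repeat r q a) x
  op_add_cons r x a₀ a₁ a := by
    rw [X.opLin_add_cons, LinearMap.sum_apply]
    rfl
  op_linear r c x y a := by rw [map_add, map_smul]

theorem Hom.map_opLin {X Y : Gamma.{u, v, w} B} (f : Hom X Y) {p n : ℕ} (r : Comp p n)
    (x : Inv M r.young) (a : Fin p → X.carrier) :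
    f.toLinearMap (X.opLin r a x) = Y.opLin r (fun i => f.toLinearMap (a i)) x := by
  have h : f.toLinearMap ∘ₗ X.opLin r a = Y.opLin r fun i => f.toLinearMap (a i) :=
    B.linearMap_ext_orbitSum fun x => by
      rw [LinearMap.comp_apply, opLin_orbitSum, opLin_orbitSum, f.map_op]
  exact LinearMap.congr_fun h x

theorem toGamma_toBeta (X : Gamma.{u, v, w} B) : X.toBeta.toGamma B = X :=
  Gamma.ext rfl HEq.rfl HEq.rfl <| heq_of_eq <| by
    funext p n r c a
    exact X.opLin_orbitSum r a c

/-- The functor forgetting the operations; being faithful, it reduces equalities of functors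
into `γ(M)` to equalities of objects. -/
def forgetOps (B : StableBasis M) : Gamma.{u, v, w} B ⥤ ModuleCat.{w} F where
  obj X := ModuleCat.of F X.carrier
  map f := ModuleCat.ofHom f.toLinearMap

instance : (forgetOps.{u, v, w} B).Faithful where
  map_injective h := Hom.ext (congrArg ModuleCat.Hom.hom h)

end Gamma

namespace Beta

variable {F : Type u} [Field F] {M : SigmaModule.{u, v} F}

theorem toGamma_opLin (B : StableBasis M) (X : Beta.{u, v, w} M) {p n : ℕ} (r : Comp p n)
    (a : Fin p → X.carrier) : (X.toGamma B).opLin r a = X.opLin r a :=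
  B.linearMap_ext_orbitSum fun _ => (X.toGamma B).opLin_orbitSum r a _

theorem toBeta_toGamma (B : StableBasis M) (X : Beta.{u, v, w} M) : (X.toGamma B).toBeta = X :=
  Beta.ext rfl HEq.rfl HEq.rfl <| heq_of_eq <| by
    funext p n r x a
    exact LinearMap.congr_fun (X.toGamma_opLin B r a) x

/-- The functor forgetting the operations; being faithful, it reduces equalities of functors
into `β(M)` to equalities of objects. -/
def forgetOps (M : SigmaModule.{u, v} F) : Beta.{u, v, w} M ⥤ ModuleCat.{w} F where
  obj X := ModuleCat.of F X.carrier
  map f := ModuleCat.ofHom f.toLinearMap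

instance : (forgetOps.{u, v, w} M).Faithful where
  map_injective h := Hom.ext (congrArg ModuleCat.Hom.hom h)

end Beta

/-- The inverse `O_M : γ(M) ⥤ β(M)` of `P_M`, which extends the operations linearly to all
invariants and does not change the underlying linear maps. -/
noncomputable def functorO {F : Type u} [Field F] {M : SigmaModule.{u, v} F}
    (B : StableBasis M) : Gamma.{u, v, w} B ⥤ Beta.{u, v, w} M where
  obj X := X.toBeta
  map f := ⟨f.toLinearMap, fun r x a => f.map_opLin r x a⟩

theorem functor_eq_of_comp_faithful_eq {C D E : Type*} [Category* C] [Category* D] [Category* E]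
    {P Q : C ⥤ D} (U : D ⥤ E) [U.Faithful] (hobj : ∀ X, P.obj X = Q.obj X)
    (hU : P ⋙ U = Q ⋙ U) : P = Q :=
  CategoryTheory.Functor.ext hobj fun X Y f => U.map_injective <| by
    simpa [eqToHom_map] using CategoryTheory.Functor.congr_hom hU f

end GenDivPow

open CategoryTheory in
theorem mainTheorem5 {F : Type u} [Field F] (M : GenDivPow.SigmaModule.{u, v} F)
    (B : GenDivPow.StableBasis M) :
    ∃ O : GenDivPow.Gamma.{u, v, w} B ⥤ GenDivPow.Beta.{u, v, w} M,
      GenDivPow.functorP.{u, v, w} B ⋙ O = 𝟭 (GenDivPow.Beta.{u, v, w} M) ∧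
        O ⋙ GenDivPow.functorP.{u, v, w} B = 𝟭 (GenDivPow.Gamma.{u, v, w} B) :=
  ⟨GenDivPow.functorO B,
    GenDivPow.functor_eq_of_comp_faithful_eq (GenDivPow.Beta.forgetOps M)
      (GenDivPow.Beta.toBeta_toGamma B) rfl,
    GenDivPow.functor_eq_of_comp_faithful_eq (GenDivPow.Gamma.forgetOps B)
      GenDivPow.Gamma.toGamma_toBeta rfl⟩
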